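/- Let $u=(x^i,y^a)$, $i=1,2,3$, $a=4,5$, $y^4=v$, be coordinates on an open set $U\subset\mathbb R^5$. For a function $\omega$ on $U$ consider the metric $${}^{\omega}\mathbf g=\epsilon_1\,dx^1\otimes dx^1+\sum_{\hat\imath=2,3} g_{\hat\imath}(x^2,x^3)\,dx^{\hat\imath}\otimes dx^{\hat\imath}+\omega^2(x^i,y^a)\sum_{a=4,5}h_a(x^i,v)\,\mathbf e^a\otimes\mathbf e^a,$$ $$\mathbf e^4=dy^4+w_i(x^k,v)\,dx^i,\qquad \mathbf e^5=dy^5+n_i(x^k,v)\,dx^i,$$ where $\epsilon_1=\pm1$, all coefficients and $\omega$ are of class $C^2$, and $g_{\hat\imath},h_a,\omega$ vanish nowhere on $U$. Put $N^4_i=w_i$, $N^5_i=n_i$, $\mathbf e_i=\partial_i-N^a_i\partial_a$, $e_a=\partial_a$. For a metric $g_{ij}\,dx^i\otimes dx^j+h_{ab}\,\mathbf e^a\otimes\mathbf e^b$ the canonical d-connection $\widehat{\mathbf D}$ has, in the frame $(\mathbf e_i,e_a)$, the coefficients $$\widehat L^i_{jk}=\tfrac12 g^{ir}(\mathbf e_kg_{jr}+\mathbf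 e_jg_{kr}-\mathbf e_rg_{jk}),\quad \widehat L^a_{bk}=e_bN^a_k+\tfrac12h^{ac}(\mathbf e_kh_{bc}-h_{dc}e_bN^d_k-h_{db}e_cN^d_k),$$ $$\widehat C^i_{jc}=\tfrac12g^{ik}e_cg_{jk},\quad \widehat C^a_{bc}=\tfrac12h^{ad}(e_ch_{bd}+e_bh_{cd}-e_dh_{bc}),$$ i.e. $\widehat{\mathbf D}_{\mathbf e_k}\mathbf e_j=\widehat L^i_{jk}\mathbf e_i$, $\widehat{\mathbf D}_{\mathbf e_k}e_b=\widehat L^a_{bk}e_a$, $\widehat{\mathbf D}_{e_c}\mathbf e_j=\widehat C^i_{jc}\mathbf e_i$, $\widehat{\mathbf D}_{e_c}e_b=\widehat C^a_{bc}e_a$. Let $\widehat T^c_{ja}=\widehat L^c_{aj}-e_aN^c_j$; let $\widehat R_{\alpha\beta}$ be the Ricci tensor of $\widehat{\mathbf D}$, that is, the contraction of $\tau$ in the $\mathbf e_\tau$-component of $\big(\widehat{\mathbf D}_{\mathbf e_\tau}\widehat{\mathbf D}_{\mathbf e_\beta}-\widehat{\mathbf D}_{\mathbf e_\beta}\widehat{\mathbf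 D}_{\mathbf e_\tau}-\widehat{\mathbf D}_{[\mathbf e_\tau,\mathbf e_\beta]}\big)\mathbf e_\alpha$; and let $\widehat E_{\alpha\beta}=\widehat R_{\alpha\beta}-\tfrac12\mathbf g_{\alpha\beta}\mathbf g^{\mu\nu}\widehat R_{\mu\nu}$ be its Einstein tensor. Objects without the label $\omega$ belong to the metric with $\omega=1$, which is invariant under $\partial/\partial y^5$; those labelled by $\omega$ belong to ${}^\omega\mathbf g$. Suppose that the metric with $\omega=1$ satisfies $\widehat R^{\alpha}{}_{\beta}=\Upsilon^{\alpha}{}_{\beta}$ on $U$ for some diagonal source $\Upsilon^\alpha{}_\beta=\mathrm{diag}[\Upsilon_\gamma(u)]$, that $\widehat T^c_{ja}=0$, and that $\mathbf e_k\omega=0$ for $k=1,2,3$. Then on $U$ $${}^{\omega}\widehat R^{a}{}_{b}=\widehat R^{a}{}_{b}+{}^{\omega}\widehat Z\,\delta^a_b,\qquad {}^{\omega}\widehat R_{ai}=\widehat R_{ai}=0,\qquad {}^{\omega}\widehat R_{ij}=\widehat R_{ij},\qquad {}^{\omega}\widehat R_{ia}=\widehat R_{ia},$$ where ${}^\omega\widehat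 Z$ is the two-dimensional conformal term $${}^{\omega}\widehat Z=\omega^{-2}\big(K-\Delta_h\ln|\omega|\big)-K,\qquad K=\tfrac12h^{ab}\widehat R_{ab},\qquad \Delta_hf=h^{ab}(e_ae_bf-\widehat C^c_{ab}e_cf),$$ with $h_{ab}=\mathrm{diag}[h_4,h_5]$. Consequently the field equations hold for ${}^\omega\mathbf g$ with a redefined source: ${}^\omega\widehat R^\alpha{}_\beta=\mathrm{diag}[\Upsilon_1,\Upsilon_2,\Upsilon_3,\Upsilon_4+{}^\omega\widehat Z,\Upsilon_5+{}^\omega\widehat Z]$. Moreover, whenever $\widehat E^\alpha{}_\beta=\mathrm{diag}[S_2+S_4,S_2,S_2,S_4,S_4]$ on $U$ for functions $S_2,S_4$, the same equation holds for ${}^\omega\widehat E^\alpha{}_\beta$ with $S_2$ replaced by $S_2-{}^\omega\widehat Z$. -/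

import Mathlib

/-- Coordinates `u = (x, y)` with `x = (x¹, x², x³)` (indices `0, 1, 2`) and
`y = (y⁴, y⁵) = (v, y)` (indices `0, 1`). -/
abbrev Coord : Type := (Fin 3 → ℝ) × (Fin 2 → ℝ)

/-- Frame indices: horizontal `i = 1, 2, 3` and vertical `a = 4, 5`. -/
abbrev Idx : Type := Fin 3 ⊕ Fin 2

/-- The partial derivative `∂_i = ∂/∂xⁱ`. -/
noncomputable def dx (i : Fin 3) (f : Coord → ℝ) (u : Coord) : ℝ :=
  fderiv ℝ f u (Pi.single i 1, 0)

/-- The partial derivative `e_a = ∂_a = ∂/∂yᵃ`. -/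
noncomputable def dy (a : Fin 2) (f : Coord → ℝ) (u : Coord) : ℝ :=
  fderiv ℝ f u (0, Pi.single a 1)

/-- A metric `g_ij eⁱ ⊗ eʲ + h_ab eᵃ ⊗ eᵇ` in N-adapted form, where `eⁱ = dxⁱ` and
`eᵃ = dyᵃ + N_iᵃ dxⁱ`; here `N u a i` is `N_iᵃ(u)`. -/
structure DMetric where
  g : Coord → Matrix (Fin 3) (Fin 3) ℝ
  h : Coord → Matrix (Fin 2) (Fin 2) ℝ
  N : Coord → Matrix (Fin 2) (Fin 3) ℝ

namespace DMetric

/-- The horizontal frame vectors `e_i = ∂_i - N_iᵃ ∂_a`, acting on functions. -/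
noncomputable def eh (M : DMetric) (i : Fin 3) (f : Coord → ℝ) (u : Coord) : ℝ :=
  dx i f u - ∑ a, M.N u a i * dy a f u

/-- The N-adapted frame `e_α = (e_i, ∂_a)`, acting on functions. -/
noncomputable def e (M : DMetric) : Idx → (Coord → ℝ) → Coord → ℝ
  | .inl i => M.eh i
  | .inr a => dy a

/-- Horizontal coefficients `Lⁱ_jk` of the canonical d-connection. -/
noncomputable def Lh (M : DMetric) (i j k : Fin 3) (u : Coord) : ℝ :=
  (1 / 2) * ∑ r, (M.g u)⁻¹ i r *
    (M.eh k (fun p => M.g p j r) u + M.eh j (fun p => M.g p k r) u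
      - M.eh r (fun p => M.g p j k) u)

/-- Coefficients `Lᵃ_bk` of the canonical d-connection. -/
noncomputable def Lv (M : DMetric) (a b : Fin 2) (k : Fin 3) (u : Coord) : ℝ :=
  dy b (fun p => M.N p a k) u + (1 / 2) * ∑ c, (M.h u)⁻¹ a c *
    (M.eh k (fun p => M.h p b c) u
      - ∑ d, M.h u d c * dy b (fun p => M.N p d k) u
      - ∑ d, M.h u d b * dy c (fun p => M.N p d k) u)

/-- Coefficients `Cⁱ_jc` of the canonical d-connection. -/
noncomputable def Ch (M : DMetric) (i j : Fin 3) (c : Fin 2) (u : Coord) : ℝ :=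
  (1 / 2) * ∑ k, (M.g u)⁻¹ i k * dy c (fun p => M.g p j k) u

/-- Vertical coefficients `Cᵃ_bc` of the canonical d-connection. -/
noncomputable def Cv (M : DMetric) (a b c : Fin 2) (u : Coord) : ℝ :=
  (1 / 2) * ∑ d, (M.h u)⁻¹ a d *
    (dy c (fun p => M.h p b d) u + dy b (fun p => M.h p c d) u
      - dy d (fun p => M.h p b c) u)

/-- All coefficients `Γ^α_βγ` of the canonical d-connection in the N-adapted frame,
`D_{e_γ} e_β = Γ^α_βγ e_α`; those mixing the horizontal and vertical parts vanish. -/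
noncomputable def Gam (M : DMetric) : Idx → Idx → Idx → Coord → ℝ
  | .inl i, .inl j, .inl k => M.Lh i j k
  | .inr a, .inr b, .inl k => M.Lv a b k
  | .inl i, .inl j, .inr c => M.Ch i j c
  | .inr a, .inr b, .inr c => M.Cv a b c
  | .inl _, .inr _, _ => fun _ => 0
  | .inr _, .inl _, _ => fun _ => 0

/-- Anholonomy coefficients: `[e_α, e_β] = W^γ_αβ e_γ`, written `anh γ α β`. The nonzero ones are
`[e_i, e_j] = (e_j N_iᵃ - e_i N_jᵃ) ∂_a` and `[e_i, ∂_b] = (∂_b N_iᵃ) ∂_a = -[∂_b, e_i]`. -/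
noncomputable def anh (M : DMetric) : Idx → Idx → Idx → Coord → ℝ
  | .inr a, .inl i, .inl j => fun u =>
      M.eh j (fun p => M.N p a i) u - M.eh i (fun p => M.N p a j) u
  | .inr a, .inl i, .inr b => fun u => dy b (fun p => M.N p a i) u
  | .inr a, .inr b, .inl i => fun u => - dy b (fun p => M.N p a i) u
  | .inr _, .inr _, .inr _ => fun _ => 0
  | .inl _, _, _ => fun _ => 0

/-- The torsion coefficients `Tᶜ_ja = Lᶜ_aj - ∂_a N_jᶜ` of the canonical d-connection. -/
noncomputable def torV (M : DMetric) (c : Fin 2) (j : Fin 3) (a : Fin 2) (u : Coord) : ℝ :=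
  M.Lv c a j u - dy a (fun p => M.N p c j) u

/-- Curvature coefficients `R^α_βγδ`: the `e_α`-component of
`(D_δ D_γ - D_γ D_δ - D_{[e_δ, e_γ]}) e_β`. -/
noncomputable def riem (M : DMetric) (α β γ δ : Idx) (u : Coord) : ℝ :=
  M.e δ (M.Gam α β γ) u - M.e γ (M.Gam α β δ) u
    + ∑ τ, (M.Gam τ β γ u * M.Gam α τ δ u - M.Gam τ β δ u * M.Gam α τ γ u)
    - ∑ τ, M.anh τ δ γ u * M.Gam α β τ u

/-- The Ricci tensor `R_αβ = R^τ_αβτ` of the canonical d-connection. -/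
noncomputable def ric (M : DMetric) (α β : Idx) (u : Coord) : ℝ :=
  ∑ τ, M.riem τ α β τ u

/-- The matrix of the metric in the N-adapted frame. -/
def met (M : DMetric) (u : Coord) : Matrix Idx Idx ℝ :=
  Matrix.fromBlocks (M.g u) 0 0 (M.h u)

/-- The matrix of the inverse metric in the N-adapted frame. -/
noncomputable def metInv (M : DMetric) (u : Coord) : Matrix Idx Idx ℝ :=
  Matrix.fromBlocks (M.g u)⁻¹ 0 0 (M.h u)⁻¹

/-- Mixed Ricci components `R^α_β = g^{ατ} R_τβ`. -/
noncomputable def ricMixed (M : DMetric) (α β : Idx) (u : Coord) : ℝ :=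
  ∑ τ, M.metInv u α τ * M.ric τ β u

/-- The scalar curvature `g^{αβ} R_αβ` of the canonical d-connection. -/
noncomputable def scal (M : DMetric) (u : Coord) : ℝ :=
  ∑ α, ∑ β, M.metInv u α β * M.ric α β u

/-- The Einstein tensor `E_αβ = R_αβ - (1/2) g_αβ R` of the canonical d-connection. -/
noncomputable def ein (M : DMetric) (α β : Idx) (u : Coord) : ℝ :=
  M.ric α β u - (1 / 2) * M.met u α β * M.scal u

/-- Mixed components `E^α_β = g^{ατ} E_τβ`. -/
noncomputable def einMixed (M : DMetric) (α β : Idx) (u : Coord) : ℝ :=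
  ∑ τ, M.metInv u α τ * M.ein τ β u

/-- The Gauss curvature `(1/2) h^{ab} R_ab` of the two-dimensional vertical metric. -/
noncomputable def vGauss (M : DMetric) (u : Coord) : ℝ :=
  (1 / 2) * ∑ a, ∑ b, (M.h u)⁻¹ a b * M.ric (.inr a) (.inr b) u

/-- The Laplacian `h^{ab} (∂_a ∂_b f - Cᶜ_ab ∂_c f)` of the vertical metric. -/
noncomputable def vLap (M : DMetric) (f : Coord → ℝ) (u : Coord) : ℝ :=
  ∑ a, ∑ b, (M.h u)⁻¹ a b * (dy a (dy b f) u - ∑ c, M.Cv c a b u * dy c f u)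

/-- The change `K(ω² h) - K(h)` of the Gauss curvature of the vertical metric `h` under the
two-dimensional conformal transform with factor `ω²`:
`ω⁻² (K - Δ log |ω|) - K` (`Real.log` is the logarithm of the absolute value). -/
noncomputable def confTerm (M : DMetric) (ω : Coord → ℝ) (u : Coord) : ℝ :=
  (ω u ^ 2)⁻¹ * (M.vGauss u - M.vLap (fun p => Real.log (ω p)) u) - M.vGauss u

end DMetric

/-- Coefficients `ε₁, g₂, g₃, h₄, h₅, w_i, n_i` of the ansatz, each with the variables it may
depend on: `g₂, g₃` on `(x², x³)`, all others on `(x, v)`. -/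
structure Ansatz where
  ε₁ : ℝ
  g₂ : ℝ → ℝ → ℝ
  g₃ : ℝ → ℝ → ℝ
  h₄ : (Fin 3 → ℝ) → ℝ → ℝ
  h₅ : (Fin 3 → ℝ) → ℝ → ℝ
  w : Fin 3 → (Fin 3 → ℝ) → ℝ → ℝ
  n : Fin 3 → (Fin 3 → ℝ) → ℝ → ℝ

namespace Ansatz

/-- The metric `ε₁ dx¹ ⊗ dx¹ + g₂ dx² ⊗ dx² + g₃ dx³ ⊗ dx³ + ω² h₄ e⁴ ⊗ e⁴ + ω² h₅ e⁵ ⊗ e⁵` with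
`e⁴ = dv + w_i dxⁱ`, `e⁵ = dy⁵ + n_i dxⁱ`. -/
noncomputable def toDMetric (A : Ansatz) (ω : Coord → ℝ) : DMetric where
  g := fun u => Matrix.diagonal ![A.ε₁, A.g₂ (u.1 1) (u.1 2), A.g₃ (u.1 1) (u.1 2)]
  h := fun u => Matrix.diagonal
    ![ω u ^ 2 * A.h₄ u.1 (u.2 0), ω u ^ 2 * A.h₅ u.1 (u.2 0)]
  N := fun u => Matrix.of
    ![fun i => A.w i u.1 (u.2 0), fun i => A.n i u.1 (u.2 0)]

/-- The coefficients are twice continuously differentiable on `U` and the metric is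
nondegenerate there (of arbitrary signature), with `ε₁ = ±1`. -/
structure RegularOn (A : Ansatz) (U : Set Coord) : Prop where
  eps : A.ε₁ = 1 ∨ A.ε₁ = -1
  g₂_smooth : ContDiffOn ℝ 2 (fun u : Coord => A.g₂ (u.1 1) (u.1 2)) U
  g₃_smooth : ContDiffOn ℝ 2 (fun u : Coord => A.g₃ (u.1 1) (u.1 2)) U
  h₄_smooth : ContDiffOn ℝ 2 (fun u : Coord => A.h₄ u.1 (u.2 0)) U
  h₅_smooth : ContDiffOn ℝ 2 (fun u : Coord => A.h₅ u.1 (u.2 0)) U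
  w_smooth : ∀ i, ContDiffOn ℝ 2 (fun u : Coord => A.w i u.1 (u.2 0)) U
  n_smooth : ∀ i, ContDiffOn ℝ 2 (fun u : Coord => A.n i u.1 (u.2 0)) U
  g₂_ne : ∀ u ∈ U, A.g₂ (u.1 1) (u.1 2) ≠ 0
  g₃_ne : ∀ u ∈ U, A.g₃ (u.1 1) (u.1 2) ≠ 0
  h₄_ne : ∀ u ∈ U, A.h₄ u.1 (u.2 0) ≠ 0
  h₅_ne : ∀ u ∈ U, A.h₅ u.1 (u.2 0) ≠ 0

end Ansatz

/-- The diagonal source `diag[S_γ]`. -/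
def diagSource (S : Idx → Coord → ℝ) (α β : Idx) (u : Coord) : ℝ :=
  if α = β then S α u else 0

/-- The diagonal entries `(S₂ + S₄, S₂, S₂, S₄, S₄)`. -/
def sourceEntries (S₂ S₄ : Coord → ℝ) : Idx → Coord → ℝ
  | .inl i => fun u => if i = 0 then S₂ u + S₄ u else S₂ u
  | .inr _ => S₄

/-! The connection preserves the horizontal and vertical subspaces, so each Ricci row is a trace
over one block only. The rows `R_iβ` are built from `Lh`, `Ch` and `N`, none of which contains the
vertical metric; they cannot see `ω` (`Ansatz.ric_horizontal`).

The block `R_ab` is the Ricci tensor of the two-dimensional metric `h` in the variables `y` at fixed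
`x`. In dimension two it equals `K h_ab` (`ric_vertical_diagonal`), and `K` becomes `ω⁻² (K - Δ log
|ω|)` for `ω² h` (`gauss_conformal`). Hence the mixed components change by the conformal term times
`δ`.

The block `R_ai` is the delicate one. Since `e_k ω = 0`, the torsion is unchanged and still zero, so
`Lᵃ_bk = ∂_b N_kᵃ` for both metrics. What remains of `ω` enters through the trace of `Cv`, shifted
by `2 ∂_a log |ω|`; its contribution cancels by the commutator `[e_i, ∂_a]` applied to `ω`. The
value zero comes from the diagonal source.

Finally the scalar curvature grows by twice the conformal term, so in the Einstein tensor the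
vertical block is unchanged and the horizontal diagonal loses the term once. -/

open Filter Topology

/-! ### Calculus of coordinate derivatives and of the N-adapted frame -/

theorem dx_add {f g : Coord → ℝ} {u : Coord} (hf : DifferentiableAt ℝ f u)
    (hg : DifferentiableAt ℝ g u) (i : Fin 3) :
    dx i (fun p => f p + g p) u = dx i f u + dx i g u := by
  simp only [dx]; rw [fderiv_fun_add hf hg]; rfl

theorem dy_add {f g : Coord → ℝ} {u : Coord} (hf : DifferentiableAt ℝ f u)
    (hg : DifferentiableAt ℝ g u) (a : Fin 2) :
    dy a (fun p => f p + g p) u = dy a f u + dy a g u := by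
  simp only [dy]; rw [fderiv_fun_add hf hg]; rfl

theorem dx_mul {f g : Coord → ℝ} {u : Coord} (hf : DifferentiableAt ℝ f u)
    (hg : DifferentiableAt ℝ g u) (i : Fin 3) :
    dx i (fun p => f p * g p) u = dx i f u * g u + f u * dx i g u := by
  simp only [dx]; rw [fderiv_fun_mul hf hg]; simp; ring

theorem dy_mul {f g : Coord → ℝ} {u : Coord} (hf : DifferentiableAt ℝ f u)
    (hg : DifferentiableAt ℝ g u) (a : Fin 2) :
    dy a (fun p => f p * g p) u = dy a f u * g u + f u * dy a g u := by
  simp only [dy]; rw [fderiv_fun_mul hf hg]; simp; ring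

theorem fderiv_fun_div_apply {f g : Coord → ℝ} {u : Coord} (hf : DifferentiableAt ℝ f u)
    (hg : DifferentiableAt ℝ g u) (h0 : g u ≠ 0) (v : Coord) :
    fderiv ℝ (fun p => f p / g p) u v =
      (fderiv ℝ f u v * g u - f u * fderiv ℝ g u v) / g u ^ 2 := by
  have h := hf.hasFDerivAt.mul ((hasDerivAt_inv h0).comp_hasFDerivAt u hg.hasFDerivAt)
  have he : (fun p => f p / g p) = f * ((fun x => x⁻¹) ∘ g) := by
    funext p; simp [div_eq_mul_inv]
  rw [he, h.fderiv]
  simp; field_simp; ring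

theorem differentiableAt_fun_div {f g : Coord → ℝ} {u : Coord} (hf : DifferentiableAt ℝ f u)
    (hg : DifferentiableAt ℝ g u) (h0 : g u ≠ 0) :
    DifferentiableAt ℝ (fun p => f p / g p) u := by
  simp only [div_eq_mul_inv]
  exact hf.fun_mul (hg.fun_inv h0)

theorem dx_div {f g : Coord → ℝ} {u : Coord} (hf : DifferentiableAt ℝ f u)
    (hg : DifferentiableAt ℝ g u) (h0 : g u ≠ 0) (i : Fin 3) :
    dx i (fun p => f p / g p) u = (dx i f u * g u - f u * dx i g u) / g u ^ 2 :=
  fderiv_fun_div_apply hf hg h0 _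

theorem dy_div {f g : Coord → ℝ} {u : Coord} (hf : DifferentiableAt ℝ f u)
    (hg : DifferentiableAt ℝ g u) (h0 : g u ≠ 0) (a : Fin 2) :
    dy a (fun p => f p / g p) u = (dy a f u * g u - f u * dy a g u) / g u ^ 2 :=
  fderiv_fun_div_apply hf hg h0 _

@[simp] theorem dx_const (i : Fin 3) (c : ℝ) (u : Coord) : dx i (fun _ => c) u = 0 := by
  simp [dx]

@[simp] theorem dy_const (a : Fin 2) (c : ℝ) (u : Coord) : dy a (fun _ => c) u = 0 := by
  simp [dy]

theorem dx_congr {f g : Coord → ℝ} {u : Coord} (h : f =ᶠ[𝓝 u] g) (i : Fin 3) :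
    dx i f u = dx i g u := by
  simp only [dx, h.fderiv_eq]

theorem dy_congr {f g : Coord → ℝ} {u : Coord} (h : f =ᶠ[𝓝 u] g) (a : Fin 2) :
    dy a f u = dy a g u := by
  simp only [dy, h.fderiv_eq]

theorem DMetric.eh_congr (M : DMetric) {f g : Coord → ℝ} {u : Coord} (h : f =ᶠ[𝓝 u] g)
    (i : Fin 3) : M.eh i f u = M.eh i g u := by
  simp only [DMetric.eh, dx_congr h, dy_congr h]

theorem differentiableAt_fderiv_apply {f : Coord → ℝ} {u : Coord} (hf : ContDiffAt ℝ 2 f u)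
    (v : Coord) : DifferentiableAt ℝ (fun p => fderiv ℝ f p v) u := by
  have h : ContDiffAt ℝ 1 (fderiv ℝ f) u := hf.fderiv_right (by norm_num)
  exact (h.differentiableAt (by norm_num)).clm_apply (differentiableAt_const v)

theorem differentiableAt_dy {f : Coord → ℝ} {u : Coord} (hf : ContDiffAt ℝ 2 f u)
    (a : Fin 2) : DifferentiableAt ℝ (dy a f) u :=
  differentiableAt_fderiv_apply hf _

theorem differentiableAt_dx {f : Coord → ℝ} {u : Coord} (hf : ContDiffAt ℝ 2 f u)
    (i : Fin 3) : DifferentiableAt ℝ (dx i f) u :=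
  differentiableAt_fderiv_apply hf _

theorem fderiv_fderiv_apply_comm {f : Coord → ℝ} {u : Coord} (hf : ContDiffAt ℝ 2 f u)
    (v w : Coord) :
    fderiv ℝ (fun p => fderiv ℝ f p v) u w = fderiv ℝ (fun p => fderiv ℝ f p w) u v := by
  have h : ContDiffAt ℝ 1 (fderiv ℝ f) u := hf.fderiv_right (by norm_num)
  have hd := h.differentiableAt (by norm_num)
  rw [fderiv_clm_apply hd (differentiableAt_const v),
    fderiv_clm_apply hd (differentiableAt_const w)]
  simpa using (hf.isSymmSndFDerivAt (by simp)).eq w v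

theorem dy_dy_comm {f : Coord → ℝ} {u : Coord} (hf : ContDiffAt ℝ 2 f u) (a b : Fin 2) :
    dy a (dy b f) u = dy b (dy a f) u :=
  fderiv_fderiv_apply_comm hf _ _

theorem dx_dy_comm {f : Coord → ℝ} {u : Coord} (hf : ContDiffAt ℝ 2 f u) (i : Fin 3)
    (a : Fin 2) : dx i (dy a f) u = dy a (dx i f) u :=
  fderiv_fderiv_apply_comm hf _ _

theorem eventually_differentiableAt {f : Coord → ℝ} {u : Coord} (hf : ContDiffAt ℝ 2 f u) :
    ∀ᶠ p in 𝓝 u, DifferentiableAt ℝ f p :=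
  (hf.eventually (by simp)).mono fun _ h => h.differentiableAt (by norm_num)

theorem dy_dy_mul {f g : Coord → ℝ} {u : Coord} (hf : ContDiffAt ℝ 2 f u)
    (hg : ContDiffAt ℝ 2 g u) (a b : Fin 2) :
    dy a (dy b (fun p => f p * g p)) u =
      dy a (dy b f) u * g u + dy b f u * dy a g u + (dy a f u * dy b g u + f u * dy a (dy b g) u) := by
  have h : dy b (fun p => f p * g p) =ᶠ[𝓝 u] fun p => dy b f p * g p + f p * dy b g p := by
    filter_upwards [eventually_differentiableAt hf, eventually_differentiableAt hg] with p h1 h2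
    exact dy_mul h1 h2 b
  have h1 := hf.differentiableAt (by norm_num)
  have h2 := hg.differentiableAt (by norm_num)
  have h3 := differentiableAt_dy hf b
  have h4 := differentiableAt_dy hg b
  rw [dy_congr h, dy_add (h3.fun_mul h2) (h1.fun_mul h4), dy_mul h3 h2, dy_mul h1 h4]

/-- The commutator `[e_i, ∂_a] = (∂_a N_iᵇ) ∂_b`. -/
theorem DMetric.dy_eh {M : DMetric} {f : Coord → ℝ} {u : Coord} (hf : ContDiffAt ℝ 2 f u)
    {i : Fin 3} (hN : ∀ b, DifferentiableAt ℝ (fun p => M.N p b i) u) (a : Fin 2) :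
    dy a (M.eh i f) u = M.eh i (dy a f) u - ∑ b, dy a (fun p => M.N p b i) u * dy b f u := by
  -- With the minus sign moved onto the derivatives of `f`, only the sum and product rules are
  -- needed.
  have h : M.eh i f = fun p => dx i f p + (M.N p 0 i * (-dy 0 f p) + M.N p 1 i * (-dy 1 f p)) := by
    funext p; simp only [DMetric.eh, Fin.sum_univ_two]; ring
  have hneg : ∀ b, dy a (fun p => -dy b f p) u = -dy a (dy b f) u := by
    intro b; simp only [dy, fderiv_fun_neg]; rfl
  have hd := fun b => differentiableAt_dy hf b
  rw [h, dy_add (differentiableAt_dx hf i)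
    (((hN 0).fun_mul (hd 0).fun_neg).fun_add ((hN 1).fun_mul (hd 1).fun_neg)),
    dy_add ((hN 0).fun_mul (hd 0).fun_neg) ((hN 1).fun_mul (hd 1).fun_neg),
    dy_mul (hN 0) (hd 0).fun_neg, dy_mul (hN 1) (hd 1).fun_neg, hneg, hneg]
  simp only [DMetric.eh, Fin.sum_univ_two, dx_dy_comm hf, dy_dy_comm hf a]
  ring

theorem DMetric.eh_add (M : DMetric) {f g : Coord → ℝ} {u : Coord} (hf : DifferentiableAt ℝ f u)
    (hg : DifferentiableAt ℝ g u) (i : Fin 3) :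
    M.eh i (fun p => f p + g p) u = M.eh i f u + M.eh i g u := by
  simp only [DMetric.eh, dx_add hf hg, dy_add hf hg, Fin.sum_univ_two]; ring

theorem DMetric.eh_mul (M : DMetric) {f g : Coord → ℝ} {u : Coord} (hf : DifferentiableAt ℝ f u)
    (hg : DifferentiableAt ℝ g u) (i : Fin 3) :
    M.eh i (fun p => f p * g p) u = M.eh i f u * g u + f u * M.eh i g u := by
  simp only [DMetric.eh, dx_mul hf hg, dy_mul hf hg, Fin.sum_univ_two]; ring

theorem DMetric.eh_div (M : DMetric) {f g : Coord → ℝ} {u : Coord} (hf : DifferentiableAt ℝ f u)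
    (hg : DifferentiableAt ℝ g u) (h0 : g u ≠ 0) (i : Fin 3) :
    M.eh i (fun p => f p / g p) u = (M.eh i f u * g u - f u * M.eh i g u) / g u ^ 2 := by
  simp only [DMetric.eh, dx_div hf hg h0, dy_div hf hg h0, Fin.sum_univ_two]; ring

@[simp] theorem DMetric.eh_const (M : DMetric) (i : Fin 3) (c : ℝ) (u : Coord) :
    M.eh i (fun _ => c) u = 0 := by
  simp [DMetric.eh]

@[simp] theorem DMetric.e_zero (M : DMetric) (α : Idx) (u : Coord) :
    M.e α (fun _ => 0) u = 0 := by
  rcases α with i | a <;> simp [DMetric.e]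

theorem dy_log {f : Coord → ℝ} {u : Coord} (hf : DifferentiableAt ℝ f u) (h0 : f u ≠ 0)
    (a : Fin 2) : dy a (fun p => Real.log (f p)) u = dy a f u / f u := by
  simp only [dy, fderiv.log hf h0]; simp; ring

theorem dy_dy_log {f : Coord → ℝ} {u : Coord} (hf : ContDiffAt ℝ 2 f u) (h0 : f u ≠ 0)
    (a b : Fin 2) : dy a (dy b (fun p => Real.log (f p))) u =
      (dy a (dy b f) u * f u - dy b f u * dy a f u) / f u ^ 2 := by
  have h : dy b (fun p => Real.log (f p)) =ᶠ[𝓝 u] fun p => dy b f p / f p := by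
    filter_upwards [eventually_differentiableAt hf, hf.continuousAt.eventually_ne h0] with p h1 h2
    exact dy_log h1 h2 b
  rw [dy_congr h, dy_div (differentiableAt_dy hf b) (hf.differentiableAt (by norm_num)) h0]

/-! ### Curvature of the two-dimensional vertical metric -/

namespace DMetric

variable {M : DMetric} {E G : Coord → ℝ}

theorem inv_diagonal_two {x y : ℝ} (hx : x ≠ 0) (hy : y ≠ 0) :
    (Matrix.diagonal ![x, y])⁻¹ = Matrix.diagonal ![x⁻¹, y⁻¹] := by
  apply Matrix.inv_eq_right_inv
  ext i j
  fin_cases i <;> fin_cases j <;> simp [hx, hy]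

/-- Vertical coefficients of a metric with `h = diag[E, G]`. -/
theorem Cv_diagonal (hh : M.h = fun p => Matrix.diagonal ![E p, G p]) {u : Coord}
    (hE : E u ≠ 0) (hG : G u ≠ 0) :
    M.Cv 0 0 0 u = dy 0 E u / (2 * E u) ∧ M.Cv 0 0 1 u = dy 1 E u / (2 * E u) ∧
    M.Cv 0 1 0 u = dy 1 E u / (2 * E u) ∧ M.Cv 0 1 1 u = -dy 0 G u / (2 * E u) ∧
    M.Cv 1 0 0 u = -dy 1 E u / (2 * G u) ∧ M.Cv 1 0 1 u = dy 0 G u / (2 * G u) ∧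
    M.Cv 1 1 0 u = dy 0 G u / (2 * G u) ∧ M.Cv 1 1 1 u = dy 1 G u / (2 * G u) := by
  have hinv : (M.h u)⁻¹ = Matrix.diagonal ![(E u)⁻¹, (G u)⁻¹] := by
    rw [hh]
    exact inv_diagonal_two hE hG
  simp only [Cv, hinv]
  simp only [hh, Fin.sum_univ_two]
  refine ⟨?_, ?_, ?_, ?_, ?_, ?_, ?_, ?_⟩ <;> simp <;> field_simp

/-- Mixed-block coefficients vanish and the `∂_a` commute, so only derivatives along the fibre
survive: this is the Ricci tensor of `h` at fixed `x`. -/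
theorem ric_vertical (u : Coord) (a b : Fin 2) :
    M.ric (.inr a) (.inr b) u =
      ∑ c, (dy c (M.Cv c a b) u - dy b (M.Cv c a c) u
        + ∑ d, (M.Cv d a b u * M.Cv c d c u - M.Cv d a c u * M.Cv c d b u)) := by
  simp [ric, riem, Gam, anh, e, Fin.sum_univ_two]

/-- The Gauss curvature of the vertical metric `diag[E, G]`. -/
noncomputable def gauss (E G : Coord → ℝ) (u : Coord) : ℝ :=
  -(dy 0 (dy 0 G) u + dy 1 (dy 1 E) u - (dy 0 E u * dy 0 G u + dy 1 E u ^ 2) / (2 * E u)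
    - (dy 0 G u ^ 2 + dy 1 E u * dy 1 G u) / (2 * G u)) / (2 * E u * G u)

/-- A two-dimensional curvature tensor has a single independent component, so Ricci is proportional
to the metric. Here this is checked directly from the eight Christoffel symbols. -/
theorem ric_vertical_diagonal (hh : M.h = fun p => Matrix.diagonal ![E p, G p]) {u : Coord}
    (hE : ContDiffAt ℝ 2 E u) (hG : ContDiffAt ℝ 2 G u) (hE0 : E u ≠ 0) (hG0 : G u ≠ 0)
    (a b : Fin 2) :
    M.ric (.inr a) (.inr b) u = gauss E G u * M.h u a b := by
  -- Each symbol is `±∂_d F / (2 H)` with `F`, `H` among `E`, `G`. The formula holds only where `E`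
  -- and `G` are nonzero, which by continuity is a neighbourhood of `u`; so it may be differentiated
  -- there.
  have key : ∀ (c : Fin 2) {C F H : Coord → ℝ}, ContDiffAt ℝ 2 F u → ContDiffAt ℝ 2 H u →
      H u ≠ 0 → ∀ (d : Fin 2), (∀ p, E p ≠ 0 → G p ≠ 0 → C p = dy d F p / (2 * H p)) →
      dy c C u = (dy c (dy d F) u * H u - dy d F u * dy c H u) / (2 * H u ^ 2) := by
    intro c C F H hF hH hH0 d hC
    have hev : C =ᶠ[𝓝 u] fun p => dy d F p / (2 * H p) := by
      filter_upwards [hE.continuousAt.eventually_ne hE0, hG.continuousAt.eventually_ne hG0]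
        with p h1 h2 using hC p h1 h2
    have hH1 := hH.differentiableAt (by norm_num)
    rw [dy_congr hev, dy_div (differentiableAt_dy hF d) ((differentiableAt_const 2).fun_mul hH1)
      (by simpa using hH0), dy_mul (differentiableAt_const 2) hH1]
    simp only [dy_const]
    field_simp; ring
  have keyneg : ∀ (c : Fin 2) {C F H : Coord → ℝ}, ContDiffAt ℝ 2 F u → ContDiffAt ℝ 2 H u →
      H u ≠ 0 → ∀ (d : Fin 2), (∀ p, E p ≠ 0 → G p ≠ 0 → C p = -dy d F p / (2 * H p)) →
      dy c C u = -(dy c (dy d F) u * H u - dy d F u * dy c H u) / (2 * H u ^ 2) := by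
    intro c C F H hF hH hH0 d hC
    have h1 := key c (C := fun p => -C p) hF hH hH0 d
      fun p h h' => by rw [hC p h h']; ring
    have h2 : dy c (fun p => -C p) u = -dy c C u := by simp only [dy, fderiv_fun_neg]; rfl
    rw [h2] at h1
    rw [neg_div, ← h1, neg_neg]
  obtain ⟨c000, c001, c010, c011, c100, c101, c110, c111⟩ := Cv_diagonal hh hE0 hG0
  have d000 := fun c => key c hE hE hE0 0 fun p h h' => (Cv_diagonal hh h h').1
  have d001 := fun c => key c hE hE hE0 1 fun p h h' => (Cv_diagonal hh h h').2.1
  have d010 := fun c => key c hE hE hE0 1 fun p h h' => (Cv_diagonal hh h h').2.2.1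
  have d011 := fun c => keyneg c hG hE hE0 0 fun p h h' => (Cv_diagonal hh h h').2.2.2.1
  have d100 := fun c => keyneg c hE hG hG0 1 fun p h h' => (Cv_diagonal hh h h').2.2.2.2.1
  have d101 := fun c => key c hG hG hG0 0 fun p h h' => (Cv_diagonal hh h h').2.2.2.2.2.1
  have d110 := fun c => key c hG hG hG0 0 fun p h h' => (Cv_diagonal hh h h').2.2.2.2.2.2.1
  have d111 := fun c => key c hG hG hG0 1 fun p h h' => (Cv_diagonal hh h h').2.2.2.2.2.2.2
  have sE := dy_dy_comm hE 1 0
  have sG := dy_dy_comm hG 1 0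
  rw [ric_vertical]
  simp only [hh, gauss]
  fin_cases a <;> fin_cases b <;>
    simp [Fin.sum_univ_two, c000, c001, c010, c011, c100, c101, c110, c111, d000, d001, d010, d011,
      d100, d101, d110, d111, sE, sG] <;> field_simp <;> ring

end DMetric

/-! ### Conformal change of the Gauss curvature; the trace entering `R_ai` -/

namespace DMetric

variable {M : DMetric} {E G ω : Coord → ℝ}

/-- The conformal transformation of the Gauss curvature in dimension two. -/
theorem gauss_conformal (hh : M.h = fun p => Matrix.diagonal ![E p, G p]) {u : Coord}
    (hE : ContDiffAt ℝ 2 E u) (hG : ContDiffAt ℝ 2 G u) (hω : ContDiffAt ℝ 2 ω u)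
    (hE0 : E u ≠ 0) (hG0 : G u ≠ 0) (hω0 : ω u ≠ 0) :
    gauss (fun p => ω p ^ 2 * E p) (fun p => ω p ^ 2 * G p) u =
      (ω u ^ 2)⁻¹ * (gauss E G u - M.vLap (fun p => Real.log (ω p)) u) := by
  obtain ⟨c000, c001, c010, c011, c100, c101, c110, c111⟩ := Cv_diagonal hh hE0 hG0
  have hω1 := hω.differentiableAt (by norm_num)
  have h1 : ∀ {F : Coord → ℝ}, ContDiffAt ℝ 2 F u → ∀ a,
      dy a (fun p => ω p ^ 2 * F p) u = 2 * ω u * dy a ω u * F u + ω u ^ 2 * dy a F u := by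
    intro F hF a
    simp only [pow_two]
    rw [dy_mul (hω1.fun_mul hω1) (hF.differentiableAt (by norm_num)), dy_mul hω1 hω1]
    ring
  have h2 : ∀ {F : Coord → ℝ}, ContDiffAt ℝ 2 F u → ∀ a,
      dy a (dy a (fun p => ω p ^ 2 * F p)) u =
        2 * (ω u * dy a (dy a ω) u + dy a ω u ^ 2) * F u + 4 * ω u * dy a ω u * dy a F u
          + ω u ^ 2 * dy a (dy a F) u := by
    intro F hF a
    simp only [pow_two]
    rw [dy_dy_mul (hω.mul hω) hF, dy_dy_mul hω hω, dy_mul hω1 hω1]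
    ring
  simp only [vLap, hh, inv_diagonal_two hE0 hG0, Fin.sum_univ_two, c000, c100, c011, c111,
    dy_dy_log hω hω0, dy_log hω1 hω0, gauss, h1 hE, h1 hG, h2 hE, h2 hG]
  simp
  field_simp
  ring

theorem vGauss_diagonal (hh : M.h = fun p => Matrix.diagonal ![E p, G p]) {u : Coord}
    (hE : ContDiffAt ℝ 2 E u) (hG : ContDiffAt ℝ 2 G u) (hE0 : E u ≠ 0) (hG0 : G u ≠ 0) :
    M.vGauss u = gauss E G u := by
  simp only [vGauss, ric_vertical_diagonal hh hE hG hE0 hG0]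
  simp only [hh, inv_diagonal_two hE0 hG0, Fin.sum_univ_two]
  simp
  field_simp
  ring

/-- No sum over `b`: each term of the trace `Cᵇ_ab` is half the logarithmic derivative of one
diagonal entry, so its conformal change is additive. -/
theorem Cv_trace_diagonal (hh : M.h = fun p => Matrix.diagonal ![E p, G p]) {u : Coord}
    (hE0 : E u ≠ 0) (hG0 : G u ≠ 0) (a b : Fin 2) :
    M.Cv b a b u = dy a (![E, G] b) u / (2 * ![E, G] b u) := by
  obtain ⟨c000, c001, c010, c011, c100, c101, c110, c111⟩ := Cv_diagonal hh hE0 hG0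
  fin_cases a <;> fin_cases b <;> simp [c000, c010, c101, c111]

/-- The mixed Ricci components when the torsion `Tᶜ_ja` vanishes. -/
theorem ric_vertical_horizontal {u : Coord} {i : Fin 3}
    (hL : ∀ c a, M.Lv c a i =ᶠ[𝓝 u] dy a (fun p => M.N p c i)) (a : Fin 2) :
    M.ric (.inr a) (.inl i) u =
      ∑ b, (dy b (dy a (fun p => M.N p b i)) u - M.eh i (M.Cv b a b) u
        + ∑ c, dy a (fun p => M.N p c i) u * M.Cv b c b u) := by
  have h1 := fun c a => (hL c a).eq_of_nhds
  have h2 := fun c a b => dy_congr (hL c a) b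
  simp [ric, riem, Gam, anh, e, Fin.sum_univ_two, h1, h2]
  ring

end DMetric

/-! ### Effect of the vertical factor `ω` on torsion and Ricci tensor of the ansatz -/

namespace Ansatz

variable {A : Ansatz} {U : Set Coord} {ω : Coord → ℝ} {u : Coord}

theorem toDMetric_one_h : (A.toDMetric (fun _ => 1)).h =
    fun p => Matrix.diagonal ![A.h₄ p.1 (p.2 0), A.h₅ p.1 (p.2 0)] := by
  simp [toDMetric]

theorem toDMetric_h_apply (p : Coord) (b c : Fin 2) : (A.toDMetric ω).h p b c =
    ω p ^ 2 * (A.toDMetric (fun _ => 1)).h p b c := by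
  fin_cases b <;> fin_cases c <;> simp [toDMetric]

theorem toDMetric_h_inv_apply (h4 : A.h₄ u.1 (u.2 0) ≠ 0) (h5 : A.h₅ u.1 (u.2 0) ≠ 0)
    (hω0 : ω u ≠ 0) (b c : Fin 2) : ((A.toDMetric ω).h u)⁻¹ b c =
      (ω u ^ 2)⁻¹ * ((A.toDMetric (fun _ => 1)).h u)⁻¹ b c := by
  have h : (A.toDMetric ω).h u =
    Matrix.diagonal ![ω u ^ 2 * A.h₄ u.1 (u.2 0), ω u ^ 2 * A.h₅ u.1 (u.2 0)] := rfl
  rw [h, toDMetric_one_h, DMetric.inv_diagonal_two (by positivity) (by positivity),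
    DMetric.inv_diagonal_two h4 h5]
  fin_cases b <;> fin_cases c <;> simp [mul_comm]

namespace RegularOn

theorem differentiableAt_N (hA : A.RegularOn U) (hU : U ∈ 𝓝 u) (b : Fin 2) (i : Fin 3) :
    DifferentiableAt ℝ (fun p => (A.toDMetric ω).N p b i) u := by
  fin_cases b
  · exact ((hA.w_smooth i).contDiffAt hU).differentiableAt (by norm_num)
  · exact ((hA.n_smooth i).contDiffAt hU).differentiableAt (by norm_num)

theorem differentiableAt_h (hA : A.RegularOn U) (hU : U ∈ 𝓝 u) (b c : Fin 2) :
    DifferentiableAt ℝ (fun p => (A.toDMetric (fun _ => 1)).h p b c) u := by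
  rw [toDMetric_one_h]
  fin_cases b <;> fin_cases c <;> simp
  · exact (hA.h₄_smooth.contDiffAt hU).differentiableAt (by norm_num)
  · exact (hA.h₅_smooth.contDiffAt hU).differentiableAt (by norm_num)

/-- Because `e_k ω = 0`, the factor `ω²` passes through `e_k` and then cancels against the inverse
metric. -/
theorem torV_conformal (hA : A.RegularOn U) (hU : U ∈ 𝓝 u) (hω : DifferentiableAt ℝ ω u)
    (hω0 : ω u ≠ 0) (k : Fin 3) (heω : (A.toDMetric (fun _ => 1)).eh k ω u = 0) (a b : Fin 2) :
    (A.toDMetric ω).torV a k b u = (A.toDMetric (fun _ => 1)).torV a k b u := by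
  have hu := mem_of_mem_nhds hU
  have he : ∀ b c, (A.toDMetric ω).eh k (fun p => (A.toDMetric ω).h p b c) u =
      ω u ^ 2 * (A.toDMetric (fun _ => 1)).eh k
        (fun p => (A.toDMetric (fun _ => 1)).h p b c) u := by
    intro b c
    -- The frame depends only on `N`, which is the same for both metrics by definition.
    change (A.toDMetric (fun _ => 1)).eh k _ u = _
    simp only [toDMetric_h_apply (ω := ω), pow_two]
    rw [DMetric.eh_mul _ (hω.fun_mul hω) (hA.differentiableAt_h hU b c),
      DMetric.eh_mul _ hω hω, heω]
    ring
  have hN : (A.toDMetric (fun _ => 1)).N = (A.toDMetric ω).N := rfl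
  simp only [DMetric.torV, DMetric.Lv, he, hN,
    toDMetric_h_inv_apply (hA.h₄_ne u hu) (hA.h₅_ne u hu) hω0, Fin.sum_univ_two]
  simp only [toDMetric_h_apply (ω := ω) u]
  field_simp

theorem ric_vertical (hA : A.RegularOn U) (hU : U ∈ 𝓝 u) (hω : ContDiffAt ℝ 2 ω u)
    (hω0 : ω u ≠ 0) (a b : Fin 2) :
    (A.toDMetric ω).ric (.inr a) (.inr b) u =
      (ω u ^ 2 * ((A.toDMetric (fun _ => 1)).vGauss u
          + (A.toDMetric (fun _ => 1)).confTerm ω u)) *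
        (A.toDMetric (fun _ => 1)).h u a b := by
  have hu := mem_of_mem_nhds hU
  have h4 := hA.h₄_smooth.contDiffAt hU
  have h5 := hA.h₅_smooth.contDiffAt hU
  have n4 := hA.h₄_ne u hu
  have n5 := hA.h₅_ne u hu
  rw [DMetric.ric_vertical_diagonal (M := A.toDMetric ω)
      (E := fun p => ω p ^ 2 * A.h₄ p.1 (p.2 0)) (G := fun p => ω p ^ 2 * A.h₅ p.1 (p.2 0)) rfl
      ((hω.pow 2).mul h4) ((hω.pow 2).mul h5) (by positivity) (by positivity),
    toDMetric_h_apply (ω := ω), DMetric.confTerm,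
    DMetric.vGauss_diagonal toDMetric_one_h h4 h5 n4 n5,
    DMetric.gauss_conformal toDMetric_one_h h4 h5 hω n4 n5 hω0]
  ring

/-- The only `ω`-dependent terms come from the trace of `Cv`; they combine to the commutator
identity for `e_i` and `∂_a` on `ω`, where `e_i ω = 0`. -/
theorem ric_vertical_horizontal (hA : A.RegularOn U) (hU : IsOpen U) (hu : u ∈ U)
    (hω : ContDiffOn ℝ 2 ω U) (hω0 : ∀ u ∈ U, ω u ≠ 0)
    (heω : ∀ u ∈ U, ∀ k : Fin 3, (A.toDMetric (fun _ => 1)).eh k ω u = 0)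
    (hT : ∀ u ∈ U, ∀ (c : Fin 2) (j : Fin 3) (a : Fin 2),
      (A.toDMetric (fun _ => 1)).torV c j a u = 0) (a : Fin 2) (i : Fin 3) :
    (A.toDMetric ω).ric (.inr a) (.inl i) u =
      (A.toDMetric (fun _ => 1)).ric (.inr a) (.inl i) u := by
  have hUu := hU.mem_nhds hu
  have hωu := hω.contDiffAt hUu
  have hωd := hωu.differentiableAt (by norm_num)
  have hdω := fun b => differentiableAt_dy hωu b
  rw [DMetric.ric_vertical_horizontal, DMetric.ric_vertical_horizontal]
  rotate_left
  · intro c a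
    -- Vanishing torsion is needed as an identity near `u`, since `Lᶜ_ai` gets differentiated.
    filter_upwards [hUu] with p hp
    exact sub_eq_zero.mp (hT p hp c i a)
  · intro c a
    filter_upwards [hUu] with p hp
    refine sub_eq_zero.mp (Eq.trans ?_ (hT p hp c i a))
    exact hA.torV_conformal (hU.mem_nhds hp)
      ((hω.contDiffAt (hU.mem_nhds hp)).differentiableAt (by norm_num)) (hω0 p hp) i
      (heω p hp i) c a
  set P : Fin 2 → Coord → ℝ := ![fun p => A.h₄ p.1 (p.2 0), fun p => A.h₅ p.1 (p.2 0)] with hP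
  have hPs : ∀ b, ∀ p ∈ U, ContDiffAt ℝ 2 (P b) p := by
    intro b p hp
    fin_cases b
    · exact hA.h₄_smooth.contDiffAt (hU.mem_nhds hp)
    · exact hA.h₅_smooth.contDiffAt (hU.mem_nhds hp)
  have hP0 : ∀ b, ∀ p ∈ U, P b p ≠ 0 := by
    intro b p hp
    fin_cases b
    · exact hA.h₄_ne p hp
    · exact hA.h₅_ne p hp
  have hC1 : ∀ a b, ∀ p ∈ U, (A.toDMetric (fun _ => 1)).Cv b a b p =
      dy a (P b) p / (2 * P b p) := fun a b p hp =>
    DMetric.Cv_trace_diagonal toDMetric_one_h (hA.h₄_ne p hp) (hA.h₅_ne p hp) a b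
  -- Each of the two terms of the trace gains `∂_a log |ω|`.
  have hC : ∀ a b, ∀ p ∈ U, (A.toDMetric ω).Cv b a b p =
      (A.toDMetric (fun _ => 1)).Cv b a b p + dy a ω p / ω p := by
    intro a b p hp
    have hωp := (hω.contDiffAt (hU.mem_nhds hp)).differentiableAt (by norm_num)
    have h0 := hω0 p hp
    have n4 := hA.h₄_ne p hp
    have n5 := hA.h₅_ne p hp
    have hPb := hP0 b p hp
    have h := DMetric.Cv_trace_diagonal (M := A.toDMetric ω)
      (E := fun p => ω p ^ 2 * A.h₄ p.1 (p.2 0)) (G := fun p => ω p ^ 2 * A.h₅ p.1 (p.2 0)) rfl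
      (u := p) (by positivity) (by positivity) a b
    have hb : ![fun p : Coord => ω p ^ 2 * A.h₄ p.1 (p.2 0),
        fun p => ω p ^ 2 * A.h₅ p.1 (p.2 0)] b = fun p => ω p ^ 2 * P b p := by
      fin_cases b <;> rfl
    rw [h, hb, hC1 a b p hp]
    simp only [pow_two]
    rw [dy_mul (hωp.fun_mul hωp) ((hPs b p hp).differentiableAt (by norm_num)), dy_mul hωp hωp]
    field_simp
    ring
  have hCd : ∀ a b, DifferentiableAt ℝ ((A.toDMetric (fun _ => 1)).Cv b a b) u := by
    intro a b
    have hd : DifferentiableAt ℝ (fun p => dy a (P b) p / (2 * P b p)) u :=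
      differentiableAt_fun_div (differentiableAt_dy (hPs b u hu) a)
        (((hPs b u hu).differentiableAt (by norm_num)).const_mul 2)
        (by simpa using hP0 b u hu)
    exact hd.congr_of_eventuallyEq (by filter_upwards [hUu] with p hp using hC1 a b p hp)
  -- The second term of the quotient rule contains `e_i ω` and drops out.
  have heC : ∀ b, (A.toDMetric ω).eh i ((A.toDMetric ω).Cv b a b) u =
      (A.toDMetric (fun _ => 1)).eh i ((A.toDMetric (fun _ => 1)).Cv b a b) u
        + (A.toDMetric (fun _ => 1)).eh i (dy a ω) u / ω u := by
    intro b
    have h0 := hω0 u hu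
    change (A.toDMetric (fun _ => 1)).eh i _ u = _
    rw [DMetric.eh_congr _ (g := fun p => (A.toDMetric (fun _ => 1)).Cv b a b p + dy a ω p / ω p)
        (by filter_upwards [hUu] with p hp using hC a b p hp),
      DMetric.eh_add _ (hCd a b) (differentiableAt_fun_div (hdω a) hωd h0), DMetric.eh_div _ (hdω a) hωd h0,
      heω u hu]
    field_simp
    ring
  -- As `e_i ω` is zero on a neighbourhood, `∂_a (e_i ω) = 0`, which leaves `e_i ∂_a ω = (∂_a N_iᵇ)
  -- ∂_b ω`: exactly the relation that cancels the extra terms.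
  have hcomm := DMetric.dy_eh hωu (fun b => hA.differentiableAt_N (ω := fun _ => 1) hUu b i) a
  rw [dy_congr (g := fun _ => 0) (by filter_upwards [hUu] with p hp using heω p hp i),
    dy_const] at hcomm
  have hN : (A.toDMetric ω).N = (A.toDMetric (fun _ => 1)).N := rfl
  simp only [Fin.sum_univ_two] at hcomm
  simp only [heC, hC _ _ u hu, hN, Fin.sum_univ_two]
  rw [sub_eq_zero.mp hcomm.symm]
  ring

end RegularOn

/-- The horizontal rows of the Ricci tensor do not involve the vertical metric. -/
theorem ric_horizontal (A : Ansatz) (ω : Coord → ℝ) (i : Fin 3) (β : Idx) (u : Coord) :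
    (A.toDMetric ω).ric (.inl i) β u = (A.toDMetric (fun _ => 1)).ric (.inl i) β u := by
  rcases β with j | b <;>
  · simp only [DMetric.ric, DMetric.riem, Fintype.sum_sum_type, DMetric.Gam, DMetric.e_zero,
      mul_zero, zero_mul, Finset.sum_const_zero, add_zero, sub_zero]
    -- What survives involves only `g` and `N`, on which the two metrics agree by definition.
    rfl

end Ansatz

/-! ### Mixed components, scalar curvature and Einstein tensor in block form -/

namespace DMetric

variable (M : DMetric) (u : Coord)

theorem ricMixed_inl (i : Fin 3) (β : Idx) :
    M.ricMixed (.inl i) β u = ∑ j, (M.g u)⁻¹ i j * M.ric (.inl j) β u := by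
  simp [ricMixed, metInv]

theorem ricMixed_inr (a : Fin 2) (β : Idx) :
    M.ricMixed (.inr a) β u = ∑ b, (M.h u)⁻¹ a b * M.ric (.inr b) β u := by
  simp [ricMixed, metInv]

theorem scal_eq : M.scal u = (∑ i, ∑ j, (M.g u)⁻¹ i j * M.ric (.inl i) (.inl j) u)
    + ∑ a, ∑ b, (M.h u)⁻¹ a b * M.ric (.inr a) (.inr b) u := by
  simp [scal, metInv]

variable {M u}

theorem metInv_mul_met (hg : IsUnit (M.g u).det) (hh : IsUnit (M.h u).det) :
    M.metInv u * M.met u = 1 := by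
  rw [metInv, met, Matrix.fromBlocks_multiply, Matrix.nonsing_inv_mul _ hg,
    Matrix.nonsing_inv_mul _ hh]
  simp

theorem einMixed_eq (hg : IsUnit (M.g u).det) (hh : IsUnit (M.h u).det) (α β : Idx) :
    M.einMixed α β u = M.ricMixed α β u - if α = β then (1 / 2) * M.scal u else 0 := by
  have h := congrFun (congrFun (metInv_mul_met hg hh) α) β
  rw [Matrix.mul_apply, Matrix.one_apply] at h
  have h' : ∀ τ, M.metInv u α τ * M.ein τ β u = M.metInv u α τ * M.ric τ β u
      - M.metInv u α τ * M.met u τ β * ((1 / 2) * M.scal u) := by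
    intro τ; rw [ein]; ring
  simp only [einMixed, h', Finset.sum_sub_distrib, ← Finset.sum_mul, h, ricMixed]
  split_ifs <;> simp

end DMetric

/-! ### Conformal change of mixed Ricci components and scalar curvature -/

namespace Ansatz

variable {A : Ansatz} {U : Set Coord} {ω : Coord → ℝ} {u : Coord}

namespace RegularOn

theorem isUnit_det_g (hA : A.RegularOn U) (hu : u ∈ U) :
    IsUnit ((A.toDMetric ω).g u).det := by
  have h1 : A.ε₁ ≠ 0 := by rcases hA.eps with h | h <;> simp [h]
  simp [toDMetric, Fin.prod_univ_three, h1, hA.g₂_ne u hu, hA.g₃_ne u hu]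

theorem isUnit_det_h (hA : A.RegularOn U) (hu : u ∈ U) (hω0 : ω u ≠ 0) :
    IsUnit ((A.toDMetric ω).h u).det := by
  simp [toDMetric, hω0, hA.h₄_ne u hu, hA.h₅_ne u hu]

theorem ric_vertical_one (hA : A.RegularOn U) (hU : U ∈ 𝓝 u) (a b : Fin 2) :
    (A.toDMetric (fun _ => 1)).ric (.inr a) (.inr b) u =
      (A.toDMetric (fun _ => 1)).vGauss u * (A.toDMetric (fun _ => 1)).h u a b := by
  have hu := mem_of_mem_nhds hU
  have h4 := hA.h₄_smooth.contDiffAt hU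
  have h5 := hA.h₅_smooth.contDiffAt hU
  have n4 := hA.h₄_ne u hu
  have n5 := hA.h₅_ne u hu
  rw [DMetric.vGauss_diagonal toDMetric_one_h h4 h5 n4 n5,
    DMetric.ric_vertical_diagonal toDMetric_one_h h4 h5 n4 n5]

/-- The `ω²` in the vertical Ricci tensor cancels the `ω⁻²` of the inverse metric. With all four
indices free, one identity serves both contractions: index raising and the scalar trace. -/
theorem inv_mul_ric_vertical (hA : A.RegularOn U) (hU : U ∈ 𝓝 u) (hω : ContDiffAt ℝ 2 ω u)
    (hω0 : ω u ≠ 0) (a b c d : Fin 2) :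
    ((A.toDMetric ω).h u)⁻¹ a b * (A.toDMetric ω).ric (.inr c) (.inr d) u =
      ((A.toDMetric (fun _ => 1)).h u)⁻¹ a b *
        ((A.toDMetric (fun _ => 1)).ric (.inr c) (.inr d) u
          + (A.toDMetric (fun _ => 1)).confTerm ω u * (A.toDMetric (fun _ => 1)).h u c d) := by
  have hu := mem_of_mem_nhds hU
  rw [toDMetric_h_inv_apply (hA.h₄_ne u hu) (hA.h₅_ne u hu) hω0, hA.ric_vertical hU hω hω0,
    hA.ric_vertical_one hU]
  field_simp

theorem ricMixed_vertical (hA : A.RegularOn U) (hU : U ∈ 𝓝 u) (hω : ContDiffAt ℝ 2 ω u)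
    (hω0 : ω u ≠ 0) (a b : Fin 2) :
    (A.toDMetric ω).ricMixed (.inr a) (.inr b) u =
      (A.toDMetric (fun _ => 1)).ricMixed (.inr a) (.inr b) u
        + (if a = b then (A.toDMetric (fun _ => 1)).confTerm ω u else 0) := by
  have h := congrFun (congrFun (Matrix.nonsing_inv_mul _
    (hA.isUnit_det_h (ω := fun _ => 1) (mem_of_mem_nhds hU) one_ne_zero)) a) b
  rw [Matrix.mul_apply, Matrix.one_apply] at h
  simp only [DMetric.ricMixed_inr, hA.inv_mul_ric_vertical hU hω hω0, mul_add,
    Finset.sum_add_distrib, mul_left_comm _ (DMetric.confTerm _ _ _), ← Finset.mul_sum, h]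
  simp

/-- The factor 2 is the trace of `δ` over the vertical indices; the horizontal trace is unaffected.
-/
theorem scal_conformal (hA : A.RegularOn U) (hU : U ∈ 𝓝 u) (hω : ContDiffAt ℝ 2 ω u)
    (hω0 : ω u ≠ 0) :
    (A.toDMetric ω).scal u = (A.toDMetric (fun _ => 1)).scal u
      + 2 * (A.toDMetric (fun _ => 1)).confTerm ω u := by
  have hu := mem_of_mem_nhds hU
  have n4 := hA.h₄_ne u hu
  have n5 := hA.h₅_ne u hu
  have hg : (A.toDMetric ω).g = (A.toDMetric (fun _ => 1)).g := rfl
  have ht : ∑ a, ∑ b, ((A.toDMetric (fun _ => 1)).h u)⁻¹ a b *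
      (A.toDMetric (fun _ => 1)).h u a b = 2 := by
    rw [toDMetric_one_h, DMetric.inv_diagonal_two n4 n5]
    simp [Fin.sum_univ_two, n4, n5]
    norm_num
  simp only [DMetric.scal_eq, ric_horizontal A ω, hg, hA.inv_mul_ric_vertical hU hω hω0, mul_add,
    Finset.sum_add_distrib, mul_left_comm _ (DMetric.confTerm _ _ _), ← Finset.mul_sum, ht]
  ring

end RegularOn

theorem ricMixed_horizontal (A : Ansatz) (ω : Coord → ℝ) (i : Fin 3) (β : Idx) (u : Coord) :
    (A.toDMetric ω).ricMixed (.inl i) β u = (A.toDMetric (fun _ => 1)).ricMixed (.inl i) β u := by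
  simp only [DMetric.ricMixed_inl, ric_horizontal A ω]
  rfl

end Ansatz

/-! ### Lowering the index and assembling the theorem -/

theorem DMetric.ric_inr_eq_zero {M : DMetric} {u : Coord} (hh : IsUnit (M.h u).det) {β : Idx}
    (h : ∀ a, M.ricMixed (.inr a) β u = 0) (a : Fin 2) : M.ric (.inr a) β u = 0 := by
  have h1 : (M.h u)⁻¹.mulVec (fun b => M.ric (.inr b) β u) = 0 := by
    funext b
    rw [Pi.zero_apply, ← h b, ricMixed_inr]
    rfl
  have h2 := congrArg (M.h u).mulVec h1
  rw [Matrix.mulVec_mulVec, Matrix.mul_nonsing_inv _ hh, Matrix.one_mulVec,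
    Matrix.mulVec_zero] at h2
  exact congrFun h2 a

theorem lemma1 (U : Set Coord) (hU : IsOpen U) (A : Ansatz) (hA : A.RegularOn U)
    -- for `ω = 1` the ansatz solves the field equations with a diagonal source
    (S : Idx → Coord → ℝ)
    (hsol : ∀ u ∈ U, ∀ α β : Idx,
      (A.toDMetric (fun _ => 1)).ricMixed α β u = diagSource S α β u)
    -- the vertical factor
    (ω : Coord → ℝ) (hω : ContDiffOn ℝ 2 ω U) (hω0 : ∀ u ∈ U, ω u ≠ 0)
    (heω : ∀ u ∈ U, ∀ k : Fin 3, (A.toDMetric (fun _ => 1)).eh k ω u = 0)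
    (hT : ∀ u ∈ U, ∀ (c : Fin 2) (j : Fin 3) (a : Fin 2),
      (A.toDMetric (fun _ => 1)).torV c j a u = 0) :
    -- the vertical Ricci components change by a diagonal two-dimensional conformal term
    (∀ u ∈ U, ∀ a b : Fin 2,
      (A.toDMetric ω).ricMixed (.inr a) (.inr b) u =
        (A.toDMetric (fun _ => 1)).ricMixed (.inr a) (.inr b) u
          + (if a = b then (A.toDMetric (fun _ => 1)).confTerm ω u else 0)) ∧
    -- the mixed components `R_ai` stay zero
    (∀ u ∈ U, ∀ (a : Fin 2) (i : Fin 3),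
      (A.toDMetric ω).ric (.inr a) (.inl i) u =
        (A.toDMetric (fun _ => 1)).ric (.inr a) (.inl i) u ∧
      (A.toDMetric (fun _ => 1)).ric (.inr a) (.inl i) u = 0) ∧
    -- the components `R_ij` and `R_ia` do not change
    (∀ u ∈ U, ∀ (i : Fin 3) (β : Idx),
      (A.toDMetric ω).ric (.inl i) β u =
        (A.toDMetric (fun _ => 1)).ric (.inl i) β u) ∧
    -- the field equations hold with the redefined source
    (∀ u ∈ U, ∀ α β : Idx,
      (A.toDMetric ω).ricMixed α β u =
        diagSource
          (Sum.elim (fun i => S (.inl i))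
            (fun a p => S (.inr a) p + (A.toDMetric (fun _ => 1)).confTerm ω p)) α β u) ∧
    -- the same in terms of the Einstein tensor, for sources `diag[S₂ + S₄, S₂, S₂, S₄, S₄]`
    (∀ S₂ S₄ : Coord → ℝ,
      (∀ u ∈ U, ∀ α β : Idx,
        (A.toDMetric (fun _ => 1)).einMixed α β u =
          diagSource (sourceEntries S₂ S₄) α β u) →
      ∀ u ∈ U, ∀ α β : Idx,
        (A.toDMetric ω).einMixed α β u =
          diagSource
            (sourceEntries
              (fun p => S₂ p - (A.toDMetric (fun _ => 1)).confTerm ω p) S₄) α β u) := by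
  have hωu : ∀ u ∈ U, ContDiffAt ℝ 2 ω u := fun u hu => hω.contDiffAt (hU.mem_nhds hu)
  have hvv : ∀ u ∈ U, ∀ a b : Fin 2, (A.toDMetric ω).ricMixed (.inr a) (.inr b) u =
      (A.toDMetric (fun _ => 1)).ricMixed (.inr a) (.inr b) u
        + (if a = b then (A.toDMetric (fun _ => 1)).confTerm ω u else 0) := fun u hu a b =>
    hA.ricMixed_vertical (hU.mem_nhds hu) (hωu u hu) (hω0 u hu) a b
  have hvh : ∀ u ∈ U, ∀ (a : Fin 2) (i : Fin 3),
      (A.toDMetric ω).ric (.inr a) (.inl i) u =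
        (A.toDMetric (fun _ => 1)).ric (.inr a) (.inl i) u := fun u hu a i =>
    hA.ric_vertical_horizontal hU hu hω hω0 heω hT a i
  have hvh0 : ∀ u ∈ U, ∀ (a : Fin 2) (i : Fin 3),
      (A.toDMetric (fun _ => 1)).ric (.inr a) (.inl i) u = 0 := fun u hu a i =>
    DMetric.ric_inr_eq_zero (hA.isUnit_det_h hu one_ne_zero)
      (fun b => by rw [hsol u hu]; simp [diagSource]) a
  have hmixω : ∀ u ∈ U, ∀ (a : Fin 2) (i : Fin 3),
      (A.toDMetric ω).ricMixed (.inr a) (.inl i) u = 0 := fun u hu a i => by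
    simp [DMetric.ricMixed_inr, hvh u hu, hvh0 u hu]
  refine ⟨hvv, fun u hu a i => ⟨hvh u hu a i, hvh0 u hu a i⟩,
    fun u _ i β => A.ric_horizontal ω i β u, ?_, ?_⟩
  · intro u hu α β
    rcases α with i | a
    · rw [A.ricMixed_horizontal, hsol u hu]
      rfl
    · rcases β with j | b
      · simp [hmixω u hu, diagSource]
      · rw [hvv u hu, hsol u hu]
        by_cases h : a = b <;> simp [diagSource, h]
  · intro S₂ S₄ hein u hu α β
    have hg := fun ω' => hA.isUnit_det_g (ω := ω') hu
    have h1 := hein u hu α β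
    rw [DMetric.einMixed_eq (hg _) (hA.isUnit_det_h hu one_ne_zero)] at h1
    rw [DMetric.einMixed_eq (hg _) (hA.isUnit_det_h hu (hω0 u hu)),
      hA.scal_conformal (hU.mem_nhds hu) (hωu u hu) (hω0 u hu)]
    rcases α with i | a
    · rw [A.ricMixed_horizontal]
      by_cases h : Sum.inl i = β
      · subst h
        -- All three horizontal entries contain `S₂` exactly once, and each loses half the increase
        -- of the scalar curvature, that is, one conformal term.
        by_cases hi : i = 0 <;> simp [diagSource, sourceEntries, hi] at h1 ⊢ <;> linarith
      · simpa [diagSource, h] using h1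
    · rcases β with j | b
      · simp [hmixω u hu, diagSource]
      · rw [hvv u hu]
        by_cases h : a = b
        · subst h
          -- The gain in `Rᵃ_a` and the loss from the scalar curvature cancel, so `S₄` stays.
          simp [diagSource, sourceEntries] at h1 ⊢
          linarith
        · simpa [diagSource, h] using h1
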